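/- For a function $f:\mathbb Z\to[0,\infty)$ with finite support $\{x_0<x_1<\dots<x_n\}$, let $f^{\#}:\mathbb Z\to[0,\infty)$ be given by $f^{\#}(r)=f(x_r)$ for $0\le r\le n$ and $f^{\#}(r)=0$ for all other integers $r$. Call $f$ \emph{$\#$-log-concave} if $f^{\#}(i)^2\ge f^{\#}(i-1)f^{\#}(i+1)$ for every $i\in\mathbb Z$. Let $f^{[i]}$ denote the $i$-th largest value of $f$, counted with multiplicity (so $f^{[i]}=0$ for $i>n+1$). For two such functions $f,g$, say that $f$ is \emph{majorized} by $g$, written $f\prec g$, if $\sum_{i=1}^k f^{[i]}\le\sum_{i=1}^k g^{[i]}$ for all $k\ge 1$ and $\sum_{i=1}^{M} f^{[i]}=\sum_{i=1}^{M} g^{[i]}$, where $M$ is the larger of the sizes of the two supports. Theorem. Let $N$ be a finite number and let $X_1,\dots,X_N$ be independent integer-valued random variables whose probability mass functions $f_1,\dots,f_N$ have finite support and are $\#$-log-concave. Let $X_1^{\#},\dots,X_N^{\#}$ be independent integer-valued random variables (possibly on another probability space) such that $X_j^{\#}$ has probability mass function $f_j^{\#}$ for each $j$. Then the probability mass functions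 of $X_1+\dots+X_N$ and of $X_1^{\#}+\dots+X_N^{\#}$ have finite support, and the former is majorized by the latter. -/

import Mathlib

/-- The probability mass function `x ↦ ℙ(X = x)` of an integer-valued random variable `X`. -/
noncomputable def massFn {Ω : Type*} [MeasurableSpace Ω] (μ : MeasureTheory.Measure Ω)
    (X : Ω → ℤ) (x : ℤ) : ℝ :=
  μ.real (X ⁻¹' {x})

/-- The squeezed rearrangement `f^#` of a finitely supported `f`: if the support of `f` is
`x₀ < ⋯ < xₙ`, then `f^# = ∑ r, f (x_r) • 𝟙_{r}`. -/
noncomputable def squeeze (f : ℤ → ℝ) (hf : (Function.support f).Finite) (k : ℤ) : ℝ :=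
  ∑ r : Fin hf.toFinset.card,
    Set.indicator {((r : ℕ) : ℤ)} (fun _ => f (hf.toFinset.orderEmbOfFin rfl r)) k

/-- Log-concavity of a sequence indexed by all integers. -/
def IsLogConcaveSeq (g : ℤ → ℝ) : Prop :=
  ∀ i : ℤ, g (i - 1) * g (i + 1) ≤ g i ^ 2

/-- A finitely supported function is `#`-log-concave if its squeezed rearrangement is
log-concave. -/
def IsHashLogConcave (f : ℤ → ℝ) (hf : (Function.support f).Finite) : Prop :=
  IsLogConcaveSeq (squeeze f hf)

/-- The nonzero values of a finitely supported function, with multiplicity, in decreasing order. -/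
noncomputable def sortedValues (f : ℤ → ℝ) (hf : (Function.support f).Finite) : List ℝ :=
  (hf.toFinset.val.map f).sort (· ≥ ·)

/-- The `i`-th largest value `f^{[i]}` (for `i = 1, 2, …`, counted with multiplicity) of a
nonnegative finitely supported function; it is `0` once the support is exhausted. -/
noncomputable def nthLargest (f : ℤ → ℝ) (hf : (Function.support f).Finite) (i : ℕ) : ℝ :=
  (sortedValues f hf).getD (i - 1) 0

/-- Majorization `f ≺ g` of nonnegative finitely supported functions on `ℤ`. The supports may have
different sizes; the shorter list of values is padded by zeros. -/
def Majorized (f g : ℤ → ℝ) : Prop :=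
  ∃ (hf : (Function.support f).Finite) (hg : (Function.support g).Finite),
    (∀ k : ℕ, ∑ i ∈ Finset.Icc 1 k, nthLargest f hf i ≤ ∑ i ∈ Finset.Icc 1 k, nthLargest g hg i) ∧
    ∑ i ∈ Finset.Icc 1 (max hf.toFinset.card hg.toFinset.card), nthLargest f hf i =
      ∑ i ∈ Finset.Icc 1 (max hf.toFinset.card hg.toFinset.card), nthLargest g hg i

/-! Let `S` and `S#` be the two sums and `W` the law of `S#`. Taking each `X_j` to be the support
point of rank `X_j^#` displays the law of `S` as a mixture, with weights `W r`, of the conditional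
laws of `S` given `S# = r`. The crux is that these conditional laws move stochastically to the right
by at least one unit when `r` grows by one. Hence, for fixed `t`, their masses at `t` telescope over
`r` to at most 1: the mixing kernel is doubly substochastic. This bounds the sums of `max (· - c) 0`
for every `c ≥ 0`, which together with equal totals is majorization
(`IsRankedFamily.sum_posPart_sub_le`, `Majorized.of_threshold`).

The unit shift is proved by induction on the summands (`IsRankedFamily.conv`). If the new summand
has rank law `f`, then given total rank `s` the old rank has weights `W r * f (s - r)`. From `s` to
`s + 1`, total positivity of `f` makes the old rank increase, and that of `W` makes it increase by
at most one. So exactly one of the two ranks rises, by one, and either way the sum of the values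
gains at least one. Convolution preserves total positivity (`IsPF2.tsum_conv`), which closes the
induction. -/

open Finset

/-! ### Log-concavity, total positivity and convolution -/

/-- Total positivity of order two, in four-point form: log-concavity without internal zeros. -/
def IsPF2 (W : ℤ → ℝ) : Prop :=
  ∀ p q x y : ℤ, p ≤ x → p ≤ y → p + q = x + y → W p * W q ≤ W x * W y

theorem IsLogConcaveSeq.mul_succ_le {f : ℤ → ℝ} (hf : IsLogConcaveSeq f) (h0 : ∀ i, 0 ≤ f i)
    (hpos : ∀ p i q, p ≤ i → i ≤ q → 0 < f p → 0 < f q → 0 < f i) (p : ℤ) (d : ℕ) :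
    f p * f (p + d + 1) ≤ f (p + 1) * f (p + d) := by
  induction d with
  | zero => simp [mul_comm]
  | succ d ih =>
    rcases (h0 p).eq_or_lt with h | hp
    · rw [← h, zero_mul]; exact mul_nonneg (h0 _) (h0 _)
    rcases (h0 (p + (d + 1 : ℕ) + 1)).eq_or_lt with h | hq
    · rw [← h, mul_zero]; exact mul_nonneg (h0 _) (h0 _)
    have hd : 0 < f (p + d) := hpos p _ _ (by lia) (by push_cast; lia) hp hq
    have hlc := hf (p + d + 1)
    have e1 : p + (d : ℤ) + 1 - 1 = p + d := by ring
    have e2 : p + (d : ℤ) + 1 + 1 = p + (d + 1 : ℕ) + 1 := by push_cast; ring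
    have e3 : p + ((d + 1 : ℕ) : ℤ) = p + d + 1 := by push_cast; ring
    rw [e1, e2] at hlc
    rw [e3] at hlc hq ⊢
    refine le_of_mul_le_mul_left ?_ hd
    calc f (p + d) * (f p * f (p + d + 1 + 1)) = f p * (f (p + d) * f (p + d + 1 + 1)) := by ring
      _ ≤ f p * f (p + d + 1) ^ 2 := mul_le_mul_of_nonneg_left hlc hp.le
      _ = (f p * f (p + d + 1)) * f (p + d + 1) := by ring
      _ ≤ (f (p + 1) * f (p + d)) * f (p + d + 1) := mul_le_mul_of_nonneg_right ih (h0 _)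
      _ = _ := by ring

theorem IsLogConcaveSeq.isPF2 {f : ℤ → ℝ} (hf : IsLogConcaveSeq f) (h0 : ∀ i, 0 ≤ f i)
    (hpos : ∀ p i q, p ≤ i → i ≤ q → 0 < f p → 0 < f q → 0 < f i) : IsPF2 f := by
  have key : ∀ (d : ℕ) (p y : ℤ), p + d ≤ y → f p * f (y + d) ≤ f (p + d) * f y := by
    intro d
    induction d with
    | zero => intro p y _; simp
    | succ d ih =>
      intro p y hy
      push_cast at hy ⊢
      have h1 := ih p (y + 1) (by lia)
      obtain ⟨e, he⟩ := Int.eq_ofNat_of_zero_le (show 0 ≤ y - (p + d) by lia)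
      have h2 := hf.mul_succ_le h0 hpos (p + d) e
      have e1 : p + (d : ℤ) + e = y := by lia
      rw [e1] at h2
      have e2 : y + ((d : ℤ) + 1) = y + 1 + d := by ring
      have e3 : p + ((d : ℤ) + 1) = p + d + 1 := by ring
      rw [e2, e3]
      exact h1.trans h2
  intro p q x y hx hy h
  rcases le_total x y with hxy | hxy
  · obtain ⟨d, hd⟩ := Int.eq_ofNat_of_zero_le (show 0 ≤ x - p by lia)
    have := key d p y (by lia)
    rwa [show y + (d : ℤ) = q by lia, show p + (d : ℤ) = x by lia] at this
  · obtain ⟨d, hd⟩ := Int.eq_ofNat_of_zero_le (show 0 ≤ y - p by lia)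
    have := key d p x (by lia)
    rwa [show x + (d : ℤ) = q by lia, show p + (d : ℤ) = y by lia, mul_comm (f y)] at this

/-- A symmetrised Cauchy–Binet expansion: the difference of the two products becomes a sum of
products of a minor of `W` and a minor of `f` having the same sign. -/
theorem IsPF2.tsum_conv {W f : ℤ → ℝ} (hW : IsPF2 W) (hf : IsPF2 f)
    (hfin : (Function.support W).Finite) : IsPF2 fun s => ∑' k, W k * f (s - k) := by
  intro p q x y hx hy h
  set d := x - p with hd
  have hp : p = x - d := by lia
  have hq : q = y + d := by lia
  have hprod : ∀ s t : ℤ, Summable (fun z : ℤ × ℤ => (W z.1 * f (s - z.1)) * (W z.2 * f (t - z.2))) ∧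
      (∑' k, W k * f (s - k)) * (∑' k, W k * f (t - k)) =
        ∑' z : ℤ × ℤ, (W z.1 * f (s - z.1)) * (W z.2 * f (t - z.2)) := by
    intro s t
    have h1 : ∀ s : ℤ, Summable fun k => W k * f (s - k) := fun s =>
      summable_of_hasFiniteSupport (hfin.subset fun k hk => left_ne_zero_of_mul hk)
    have h2 : Summable (fun z : ℤ × ℤ => (W z.1 * f (s - z.1)) * (W z.2 * f (t - z.2))) :=
      summable_of_hasFiniteSupport ((hfin.prod hfin).subset fun z hz =>
        ⟨left_ne_zero_of_mul (left_ne_zero_of_mul hz),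
          left_ne_zero_of_mul (right_ne_zero_of_mul hz)⟩)
    exact ⟨h2, (h1 s).tsum_mul_tsum (h1 t) h2⟩
  obtain ⟨s1, e1⟩ := hprod p q
  obtain ⟨s2, e2⟩ := hprod x y
  let τ : ℤ × ℤ ≃ ℤ × ℤ :=
    ⟨fun z => (z.1 - d, z.2 + d), fun z => (z.1 + d, z.2 - d), fun z => by simp, fun z => by simp⟩
  let σ : ℤ × ℤ ≃ ℤ × ℤ :=
    ⟨fun z => (z.2 + d, z.1 - d), fun z => (z.2 + d, z.1 - d), fun z => by simp, fun z => by simp⟩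
  let c : ℤ × ℤ → ℝ := fun z => W z.1 * W z.2 - W (z.1 - d) * W (z.2 + d)
  let g : ℤ × ℤ → ℝ := fun z => f (x - z.1) * f (y - z.2)
  have s1' := τ.summable_iff.mpr s1
  have hE : HasSum (fun z => c z * g z) ((∑' z : ℤ × ℤ, (W z.1 * f (x - z.1)) * (W z.2 * f (y - z.2)))
      - ∑' z : ℤ × ℤ, (W z.1 * f (p - z.1)) * (W z.2 * f (q - z.2))) := by
    rw [← τ.tsum_eq (fun z : ℤ × ℤ => (W z.1 * f (p - z.1)) * (W z.2 * f (q - z.2)))]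
    have hsub := s2.hasSum.sub s1'.hasSum
    rwa [show (fun z : ℤ × ℤ => W z.1 * f (x - z.1) * (W z.2 * f (y - z.2)) -
        ((fun z : ℤ × ℤ => W z.1 * f (p - z.1) * (W z.2 * f (q - z.2))) ∘ τ) z) =
        fun z => c z * g z from ?_] at hsub
    funext z
    change _ - W (z.1 - d) * f (p - (z.1 - d)) * (W (z.2 + d) * f (q - (z.2 + d))) =
      (W z.1 * W z.2 - W (z.1 - d) * W (z.2 + d)) * (f (x - z.1) * f (y - z.2))
    rw [show p - (z.1 - d) = x - z.1 by lia, show q - (z.2 + d) = y - z.2 by lia]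
    ring
  -- The involution `σ` sends `c` to `-c`, so averaging over it replaces `g` by `g - g ∘ σ`, a minor
  -- of `f`.
  have hE' := hE.add (σ.hasSum_iff.mpr hE)
  have hnn : ∀ z, 0 ≤ c z * g z + ((fun z => c z * g z) ∘ σ) z := by
    rintro ⟨k, l⟩
    have : c (k, l) * g (k, l) + ((fun z => c z * g z) ∘ σ) (k, l) =
        (W k * W l - W (k - d) * W (l + d)) *
          (f (x - k) * f (y - l) - f (x - (l + d)) * f (y - (k - d))) := by
      simp only [c, g, σ, Function.comp, Equiv.coe_fn_mk, add_sub_cancel_right, sub_add_cancel]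
      ring
    rw [this]
    rcases le_total (k - d) l with hkl | hkl
    · exact mul_nonneg (sub_nonneg.2 (hW _ _ _ _ (by lia) (by lia) (by lia)))
        (sub_nonneg.2 (hf _ _ _ _ (by lia) (by lia) (by lia)))
    · refine mul_nonneg_of_nonpos_of_nonpos (sub_nonpos.2 ?_)
        (sub_nonpos.2 (hf _ _ _ _ (by lia) (by lia) (by lia)))
      rw [mul_comm]
      exact hW _ _ _ _ (by lia) (by lia) (by lia)
  have := hE'.nonneg hnn
  simp only [e1, e2]
  linarith

theorem IsPF2.sum_range_conv {W f : ℤ → ℝ} (hW : IsPF2 W) (hf : IsPF2 f) {M : ℕ}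
    (hM : ∀ r : ℤ, ¬(0 ≤ r ∧ r < M) → W r = 0) :
    IsPF2 fun s => ∑ r ∈ range M, W r * f (s - r) := by
  have hfin : (Function.support W).Finite :=
    (Set.finite_Ico (0 : ℤ) M).subset fun r hr => by
      by_contra h; exact hr (hM r h)
  convert hW.tsum_conv hf hfin using 2 with s
  rw [tsum_eq_sum (s := (range M).map Nat.castEmbedding), sum_map]
  · rfl
  · intro k hk
    rw [hM k, zero_mul]
    rintro ⟨h1, h2⟩
    apply hk
    rw [mem_map]
    exact ⟨k.toNat, by simp; lia, by simp [h1]⟩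

/-! ### Comparing averages under interlaced weights -/

theorem sum_mul_le_sum_mul_of_interlaced (a b u v : ℕ → ℝ) (M : ℕ) (ha : ∀ r, 0 ≤ a r)
    (hb : ∀ r, 0 ≤ b r)
    (h1 : ∀ p q, p < q → b p * a q ≤ a p * b q)
    (h2 : ∀ p q, p < q → a p * b (q + 1) ≤ b (p + 1) * a q)
    (huv : ∀ r, 0 < a r → 0 < b r → v r ≤ u r)
    (huv' : ∀ r, 0 < a r → 0 < b (r + 1) → v (r + 1) ≤ u r) :
    (∑ r ∈ range M, b r * v r) * ∑ r ∈ range M, a r ≤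
      (∑ r ∈ range M, a r * u r) * ∑ r ∈ range M, b r := by
  set A := ∑ r ∈ range M, a r with hA
  set B := ∑ r ∈ range M, b r with hB
  have hA0 : 0 ≤ A := sum_nonneg fun _ _ => ha _
  have hB0 : 0 ≤ B := sum_nonneg fun _ _ => hb _
  have H1 : ∀ r ≤ M, (∑ i ∈ range r, b i) * A ≤ (∑ i ∈ range r, a i) * B := by
    intro r hr
    rw [hA, hB, ← sum_range_add_sum_Ico a hr, ← sum_range_add_sum_Ico b hr]
    have : (∑ i ∈ range r, b i) * (∑ i ∈ Ico r M, a i) ≤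
        (∑ i ∈ range r, a i) * (∑ i ∈ Ico r M, b i) := by
      rw [sum_mul_sum, sum_mul_sum]
      refine sum_le_sum fun p hp => sum_le_sum fun q hq => h1 p q ?_
      rw [mem_range] at hp
      rw [mem_Ico] at hq
      lia
    linarith
  have H2 : ∀ r ≤ M, (∑ i ∈ range r, a i) * B ≤ (∑ i ∈ range (r + 1), b i) * A := by
    intro r hr
    have hBle : B ≤ (∑ i ∈ range (r + 1), b i) + ∑ q ∈ Ico r M, b (q + 1) := by
      rw [sum_Ico_add' b r M 1, sum_range_add_sum_Ico b (by lia), sum_range_succ]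
      linarith [hb M]
    have hPb : ∑ i ∈ range r, b (i + 1) ≤ ∑ i ∈ range (r + 1), b i := by
      rw [sum_range_succ']; linarith [hb 0]
    have hPa0 : 0 ≤ ∑ i ∈ range r, a i := sum_nonneg fun _ _ => ha _
    have hTa0 : 0 ≤ ∑ i ∈ Ico r M, a i := sum_nonneg fun _ _ => ha _
    have : (∑ i ∈ range r, a i) * (∑ i ∈ Ico r M, b (i + 1)) ≤
        (∑ i ∈ range r, b (i + 1)) * (∑ i ∈ Ico r M, a i) := by
      rw [sum_mul_sum, sum_mul_sum]
      refine sum_le_sum fun p hp => sum_le_sum fun q hq => h2 p q ?_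
      rw [mem_range] at hp
      rw [mem_Ico] at hq
      lia
    have k1 := mul_le_mul_of_nonneg_left hBle hPa0
    have k2 := mul_le_mul_of_nonneg_right hPb hTa0
    rw [hA, ← sum_range_add_sum_Ico a hr]
    linarith
  -- The factor of `v r` is the mass (scaled by `A * B`) carried from index `r - 1` to `r`; `A * b
  -- r` minus it is the mass staying at `r`. `H1` and `H2` say that both are nonnegative.
  have key : ∀ r ≤ M, (∑ i ∈ range r, b i * v i) * A +
      v r * ((∑ i ∈ range r, a i) * B - (∑ i ∈ range r, b i) * A) ≤
        (∑ i ∈ range r, a i * u i) * B := by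
    intro r
    induction r with
    | zero => simp
    | succ r ih =>
      intro hr
      have ih := ih (by lia)
      have m0 := H1 r (by lia)
      have m1 := H1 (r + 1) hr
      have s0 := H2 r (by lia)
      have s1 := H2 (r + 1) hr
      rw [sum_range_succ _ (r + 1)] at s1
      simp only [sum_range_succ _ r] at m1 s0 s1 ⊢
      set PA := ∑ i ∈ range r, a i
      set PB := ∑ i ∈ range r, b i
      set m := PA * B - PB * A with hm
      set m' := (PA + a r) * B - (PB + b r) * A with hm'
      have hs : B * a r = m' + (A * b r - m) := by rw [hm, hm']; ring
      have hs0 : 0 ≤ A * b r - m := by rw [hm]; linarith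
      have hm'0 : 0 ≤ m' := by linarith
      have t1 : v r * (A * b r - m) ≤ u r * (A * b r - m) := by
        rcases hs0.eq_or_lt with h | h
        · rw [← h]; simp
        · refine mul_le_mul_of_nonneg_right (huv r ?_ ?_) hs0
          · refine (ha r).lt_of_ne fun h0 => ?_
            rw [← h0] at hs; linarith
          · refine (hb r).lt_of_ne fun h0 => ?_
            rw [← h0] at h; linarith
      have t2 : v (r + 1) * m' ≤ u r * m' := by
        rcases hm'0.eq_or_lt with h | h
        · rw [← h]; simp
        · refine mul_le_mul_of_nonneg_right (huv' r ?_ ?_) hm'0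
          · refine (ha r).lt_of_ne fun h0 => ?_
            rw [← h0] at hs; linarith
          · refine (hb (r + 1)).lt_of_ne fun h0 => ?_
            rw [← h0] at s1; linarith
      have : u r * (B * a r) = u r * m' + u r * (A * b r - m) := by rw [hs]; ring
      linarith
  have := key M le_rfl
  rw [← hA, ← hB] at this
  linarith

/-! ### Ranked families: stability and spreading -/

/-- A weight `W` on the ranks `0, …, M - 1` with a family of distribution functions `Φ r` that move
strictly to the right as the rank increases. -/
structure IsRankedFamily (W : ℤ → ℝ) (Φ : ℤ → ℤ → ℝ) (M : ℕ) : Prop where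
  pf2 : IsPF2 W
  supp : ∀ r : ℤ, ¬(0 ≤ r ∧ r < M) → W r = 0
  weight_nonneg : ∀ r, 0 ≤ W r
  cdf_nonneg : ∀ r t, 0 ≤ Φ r t
  cdf_le_one : ∀ r t, Φ r t ≤ 1
  cdf_mono : ∀ r, Monotone (Φ r)
  shift : ∀ r t, 0 < W r → 0 < W (r + 1) → Φ (r + 1) (t + 1) ≤ Φ r t

/-- The new family averages the translated old one over the old rank given the total rank `s`. Where
the new weight vanishes the quotient is 0, which is harmless since `shift` concerns positive weights
only. -/
theorem IsRankedFamily.conv {W : ℤ → ℝ} {Φ : ℤ → ℤ → ℝ} {M : ℕ} (h : IsRankedFamily W Φ M)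
    {f : ℤ → ℝ} {n : ℕ} {x : ℤ → ℤ} (hf : IsPF2 f) (f0 : ∀ i, 0 ≤ f i)
    (fn : ∀ r : ℤ, ¬(0 ≤ r ∧ r < n) → f r = 0)
    (hx : ∀ i, 0 < f i → 0 < f (i + 1) → x i < x (i + 1)) :
    IsRankedFamily (fun s => ∑ r ∈ range M, W r * f (s - r))
      (fun s t => (∑ r ∈ range M, W r * f (s - r) * Φ r (t - x (s - r))) /
        ∑ r ∈ range M, W r * f (s - r)) (M + n) where
  pf2 := h.pf2.sum_range_conv hf h.supp
  supp s hs := by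
    refine sum_eq_zero fun r hr => ?_
    rw [mem_range] at hr
    rw [fn, mul_zero]
    push_cast at hs
    lia
  weight_nonneg s := sum_nonneg fun r _ => mul_nonneg (h.weight_nonneg _) (f0 _)
  cdf_nonneg s t := div_nonneg
    (sum_nonneg fun r _ => mul_nonneg (mul_nonneg (h.weight_nonneg _) (f0 _)) (h.cdf_nonneg _ _))
    (sum_nonneg fun r _ => mul_nonneg (h.weight_nonneg _) (f0 _))
  cdf_le_one s t := div_le_one_of_le₀
    (sum_le_sum fun r _ => mul_le_of_le_one_right (mul_nonneg (h.weight_nonneg _) (f0 _))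
      (h.cdf_le_one _ _))
    (sum_nonneg fun r _ => mul_nonneg (h.weight_nonneg _) (f0 _))
  cdf_mono s t t' ht := div_le_div_of_nonneg_right
    (sum_le_sum fun r _ => mul_le_mul_of_nonneg_left (h.cdf_mono _ (by lia))
      (mul_nonneg (h.weight_nonneg _) (f0 _)))
    (sum_nonneg fun r _ => mul_nonneg (h.weight_nonneg _) (f0 _))
  shift s t h1 h2 := by
    rw [div_le_div_iff₀ h2 h1]
    have w0 := h.weight_nonneg
    have pos : ∀ {c d : ℝ}, 0 ≤ c → 0 ≤ d → 0 < c * d → 0 < c ∧ 0 < d := fun hc hd hcd =>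
      ⟨hc.lt_of_ne (left_ne_zero_of_mul hcd.ne').symm, hd.lt_of_ne (right_ne_zero_of_mul hcd.ne').symm⟩
    refine sum_mul_le_sum_mul_of_interlaced (fun r : ℕ => W r * f (s - r))
      (fun r : ℕ => W r * f (s + 1 - r)) (fun r : ℕ => Φ r (t - x (s - r)))
      (fun r : ℕ => Φ r (t + 1 - x (s + 1 - r))) M (fun r => mul_nonneg (w0 _) (f0 _))
      (fun r => mul_nonneg (w0 _) (f0 _)) ?_ ?_ ?_ ?_
    · intro p q hpq
      have := mul_le_mul_of_nonneg_left
        (hf (s - q) (s + 1 - p) (s - p) (s + 1 - q) (by lia) (by lia) (by lia))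
        (mul_nonneg (w0 p) (w0 q))
      linarith
    · intro p q hpq
      have := mul_le_mul_of_nonneg_left
        (h.pf2 p (q + 1) (p + 1) q (by lia) (by lia) (by lia))
        (mul_nonneg (f0 (s - p)) (f0 (s - q)))
      push_cast
      rw [show s + 1 - ((q : ℤ) + 1) = s - q by ring, show s + 1 - ((p : ℤ) + 1) = s - p by ring]
      linarith
    · intro r ha hb
      have hfa := (pos (w0 _) (f0 _) ha).2
      have hfb := (pos (w0 _) (f0 _) hb).2
      have e : s + 1 - (r : ℤ) = s - r + 1 := by ring
      rw [e] at hfb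
      have := hx _ hfa hfb
      rw [e]
      exact h.cdf_mono _ (by lia)
    · intro r ha hb
      have hwa := (pos (w0 _) (f0 _) ha).1
      have hwb := (pos (w0 _) (f0 _) hb).1
      push_cast at hwb ⊢
      rw [show s + 1 - ((r : ℤ) + 1) = s - r by ring,
        show t + 1 - x (s - r) = t - x (s - r) + 1 by ring]
      exact h.shift _ _ hwa hwb

/-- By `shift`, `Φ r (t - 1)` is at least `Φ (r + 1) t`, so the sum telescopes. -/
theorem IsRankedFamily.sum_cdf_sub_le_one {W : ℤ → ℝ} {Φ : ℤ → ℤ → ℝ} {M : ℕ}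
    (h : IsRankedFamily W Φ M) (t : ℤ) :
    ∑ r ∈ (range M).filter (fun r : ℕ => 0 < W r), (Φ r t - Φ r (t - 1)) ≤ 1 := by
  rw [sum_filter]
  have key : ∀ m : ℕ, (∑ r ∈ range m, if 0 < W r then Φ r t - Φ r (t - 1) else 0) ≤
      1 - if 0 < W m then Φ m t else 0 := by
    intro m
    induction m with
    | zero =>
      simp only [range_zero, sum_empty]
      split_ifs <;> linarith [h.cdf_le_one ((0 : ℕ) : ℤ) t]
    | succ m ih =>
      by_cases hm : 0 < W m
      · rw [sum_range_succ]
        simp only [hm, if_true] at ih ⊢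
        split_ifs with hm'
        · have := h.shift m (t - 1) hm (by exact_mod_cast hm')
          rw [sub_add_cancel] at this
          push_cast
          linarith
        · linarith [h.cdf_nonneg m (t - 1)]
      · have hm0 : W m = 0 := le_antisymm (not_lt.1 hm) (h.weight_nonneg _)
        split_ifs with hm'
        -- `W` has no internal zeros: as `W m = 0 < W (m + 1)`, all earlier weights vanish.
        · rw [sum_eq_zero]
          · linarith [h.cdf_le_one ((m + 1 : ℕ) : ℤ) t]
          · intro r hr
            rw [mem_range] at hr
            refine if_neg fun hr0 => ?_
            have := h.pf2 r (m + 1 : ℕ) m (r + 1) (by lia) (by lia) (by push_cast; ring)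
            rw [hm0, zero_mul] at this
            exact absurd (mul_pos hr0 hm') (not_lt.2 this)
        · rw [sum_range_succ]
          simp only [hm, if_false] at ih ⊢
          linarith
  refine (key M).trans ?_
  split_ifs <;> linarith [h.cdf_nonneg M t]

theorem sum_sub_pred_le_one {φ : ℤ → ℝ} (h0 : ∀ t, 0 ≤ φ t) (h1 : ∀ t, φ t ≤ 1)
    (hmono : Monotone φ) (T : Finset ℤ) : ∑ t ∈ T, (φ t - φ (t - 1)) ≤ 1 := by
  obtain ⟨a, ha⟩ := T.bddBelow
  obtain ⟨b, hb⟩ := T.bddAbove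
  have tele : ∀ k : ℕ, ∑ i ∈ range k, (φ (a + i) - φ (a + i - 1)) = φ (a + k - 1) - φ (a - 1) := by
    intro k
    induction k with
    | zero => simp
    | succ k ih =>
      rw [sum_range_succ, ih]
      push_cast
      rw [show a + ((k : ℤ) + 1) - 1 = a + k by ring]
      ring
  calc ∑ t ∈ T, (φ t - φ (t - 1))
      ≤ ∑ t ∈ (range (b + 1 - a).toNat).image (fun i : ℕ => a + (i : ℤ)), (φ t - φ (t - 1)) := by
        refine sum_le_sum_of_subset_of_nonneg ?_ fun t _ _ => sub_nonneg.2 (hmono (by lia))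
        intro t ht
        have h1 := ha ht
        have h2 := hb ht
        rw [mem_image]
        exact ⟨(t - a).toNat, by rw [mem_range]; lia, by lia⟩
    _ = ∑ i ∈ range (b + 1 - a).toNat, (φ (a + i) - φ (a + i - 1)) :=
        sum_image fun i _ j _ hij => by simpa using hij
    _ ≤ 1 := by
        rw [tele]
        linarith [h1 (a + (b + 1 - a).toNat - 1), h0 (a - 1)]

/-- The mixture of the distributions `Φ r` is more spread out than the weight `W`. -/
theorem IsRankedFamily.sum_posPart_sub_le {W : ℤ → ℝ} {Φ : ℤ → ℤ → ℝ} {M : ℕ}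
    (h : IsRankedFamily W Φ M) {c : ℝ} (hc : 0 ≤ c) (T : Finset ℤ) :
    ∑ t ∈ T, max ((∑ r ∈ range M, W r * (Φ r t - Φ r (t - 1))) - c) 0 ≤
      ∑ r ∈ range M, max (W r - c) 0 := by
  have hK : ∀ r t, 0 ≤ Φ r t - Φ r (t - 1) := fun r t => sub_nonneg.2 (h.cdf_mono r (by lia))
  have hle : ∀ t, max ((∑ r ∈ range M, W r * (Φ r t - Φ r (t - 1))) - c) 0 ≤
      ∑ r ∈ range M, max (W r - c) 0 * (Φ r t - Φ r (t - 1)) := by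
    intro t
    refine max_le ?_ (sum_nonneg fun r _ => mul_nonneg (le_max_right _ _) (hK _ _))
    have h1 : ∑ r ∈ range M, W r * (Φ r t - Φ r (t - 1)) =
        ∑ r ∈ (range M).filter (fun r : ℕ => 0 < W r), W r * (Φ r t - Φ r (t - 1)) := by
      rw [sum_filter]
      refine sum_congr rfl fun r _ => ?_
      split_ifs with hr
      · rfl
      · rw [le_antisymm (not_lt.1 hr) (h.weight_nonneg _), zero_mul]
    -- The kernel has mass at most 1 at `t`, so subtracting `c` costs no more than subtracting `c`
    -- from each weight.
    have h2 := mul_le_mul_of_nonneg_left (h.sum_cdf_sub_le_one t) hc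
    rw [mul_one, mul_sum] at h2
    calc (∑ r ∈ range M, W r * (Φ r t - Φ r (t - 1))) - c
        ≤ ∑ r ∈ (range M).filter (fun r : ℕ => 0 < W r), (W r - c) * (Φ r t - Φ r (t - 1)) := by
          rw [h1]
          simp only [sub_mul (W _), sum_sub_distrib] at h2 ⊢
          linarith
      _ ≤ ∑ r ∈ (range M).filter (fun r : ℕ => 0 < W r), max (W r - c) 0 * (Φ r t - Φ r (t - 1)) :=
          sum_le_sum fun r _ => mul_le_mul_of_nonneg_right (le_max_left _ _) (hK _ _)
      _ ≤ _ := sum_le_sum_of_subset_of_nonneg (filter_subset _ _) fun r _ _ =>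
          mul_nonneg (le_max_right _ _) (hK _ _)
  refine (sum_le_sum fun t _ => hle t).trans ?_
  rw [sum_comm]
  refine sum_le_sum fun r _ => ?_
  rw [← mul_sum]
  exact mul_le_of_le_one_right (le_max_right _ _)
    (sum_sub_pred_le_one (h.cdf_nonneg r) (h.cdf_le_one r) (h.cdf_mono r) T)

/-! ### Majorization through thresholds -/

theorem List.sum_take_le_of_threshold {c : ℝ} (hc : 0 ≤ c) (l : List ℝ) (k : ℕ) :
    (l.take k).sum ≤ k * c + (l.map fun x => max (x - c) 0).sum := by
  induction l generalizing k with
  | nil => simpa using by positivity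
  | cons a l ih =>
    cases k with
    | zero =>
      simp only [List.take_zero, List.sum_nil, Nat.cast_zero, zero_mul, zero_add]
      exact List.sum_nonneg (by simp)
    | succ k =>
      rw [List.take_succ_cons, List.sum_cons, List.map_cons, List.sum_cons]
      push_cast
      linarith [ih k, le_max_left (a - c) 0]

/-- The threshold is the entry at position `k`, counted from 0, or 0 past the end. The middle clause
serves the induction: it places `c` below the head. -/
theorem List.exists_threshold_le_sum_take (l : List ℝ) (hl : l.Pairwise (· ≥ ·))
    (h0 : ∀ x ∈ l, 0 ≤ x) (k : ℕ) :
    ∃ c : ℝ, 0 ≤ c ∧ (∀ b, 0 ≤ b → (∀ x ∈ l, x ≤ b) → c ≤ b) ∧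
      k * c + (l.map fun x => max (x - c) 0).sum ≤ (l.take k).sum := by
  induction l generalizing k with
  | nil => exact ⟨0, le_rfl, fun b hb _ => hb, by simp⟩
  | cons a l ih =>
    rw [List.pairwise_cons] at hl
    have ha : 0 ≤ a := h0 a (by simp)
    cases k with
    | zero =>
      refine ⟨a, ha, fun b _ hb => hb a (by simp), ?_⟩
      simp only [List.take_zero, List.sum_nil, Nat.cast_zero, zero_mul, zero_add]
      refine (List.sum_eq_zero fun y hy => ?_).le
      obtain ⟨x, hx, rfl⟩ := List.mem_map.1 hy
      refine max_eq_right (sub_nonpos.2 ?_)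
      rcases List.mem_cons.1 hx with rfl | hx
      · exact le_rfl
      · exact hl.1 x hx
    | succ k =>
      obtain ⟨c, hc, hcb, h⟩ := ih hl.2 (fun x hx => h0 x (by simp [hx])) k
      refine ⟨c, hc, fun b hb hb' => hcb b hb fun x hx => hb' x (by simp [hx]), ?_⟩
      have hca : c ≤ a := hcb a ha hl.1
      rw [List.take_succ_cons, List.sum_cons, List.map_cons, List.sum_cons,
        max_eq_left (sub_nonneg.2 hca)]
      push_cast
      linarith

theorem List.sum_range_getD (l : List ℝ) (k : ℕ) :
    ∑ i ∈ Finset.range k, l.getD i 0 = (l.take k).sum := by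
  induction k generalizing l with
  | zero => simp
  | succ k ih =>
    cases l with
    | nil => simp
    | cons a l =>
      rw [Finset.sum_range_succ', List.take_succ_cons, List.sum_cons, ← ih l]
      simp [add_comm]

theorem sum_nthLargest (f : ℤ → ℝ) (hf : (Function.support f).Finite) (k : ℕ) :
    ∑ i ∈ Icc 1 k, nthLargest f hf i = ((sortedValues f hf).take k).sum := by
  rw [← List.sum_range_getD, Finset.range_eq_Ico, Finset.sum_Ico_eq_sum_range,
    ← Finset.Ico_succ_right_eq_Icc, Finset.sum_Ico_eq_sum_range]
  simp [nthLargest]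

theorem sum_map_sortedValues (f : ℤ → ℝ) (hf : (Function.support f).Finite) (φ : ℝ → ℝ) :
    ((sortedValues f hf).map φ).sum = ∑ x ∈ hf.toFinset, φ (f x) := by
  rw [← Multiset.sum_coe, ← Multiset.map_coe, sortedValues, Multiset.sort_eq, Multiset.map_map]
  rfl

theorem sum_nthLargest_of_card_le (f : ℤ → ℝ) (hf : (Function.support f).Finite) {k : ℕ}
    (hk : hf.toFinset.card ≤ k) :
    ∑ i ∈ Icc 1 k, nthLargest f hf i = ∑ x ∈ hf.toFinset, f x := by
  rw [sum_nthLargest, List.take_of_length_le, ← List.map_id (sortedValues f hf),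
    sum_map_sortedValues]
  · rfl
  · simpa [sortedValues] using hk

/-- Majorization from comparison of the stop-loss sums at every threshold. -/
theorem Majorized.of_threshold {f g : ℤ → ℝ} (hf : (Function.support f).Finite)
    (hg : (Function.support g).Finite) (g0 : ∀ x, 0 ≤ g x)
    (htot : ∑ x ∈ hf.toFinset, f x = ∑ x ∈ hg.toFinset, g x)
    (h : ∀ c, 0 ≤ c → ∑ x ∈ hf.toFinset, max (f x - c) 0 ≤ ∑ x ∈ hg.toFinset, max (g x - c) 0) :
    Majorized f g := by
  refine ⟨hf, hg, fun k => ?_, ?_⟩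
  · rw [sum_nthLargest, sum_nthLargest]
    obtain ⟨c, hc, -, hgc⟩ := (sortedValues g hg).exists_threshold_le_sum_take
      (Multiset.pairwise_sort _ _) (fun y hy => by
        rw [sortedValues, Multiset.mem_sort, Multiset.mem_map] at hy
        obtain ⟨x, -, rfl⟩ := hy
        exact g0 x) k
    have hfc := (sortedValues f hf).sum_take_le_of_threshold hc k
    rw [sum_map_sortedValues] at hfc hgc
    linarith [h c hc]
  · rw [sum_nthLargest_of_card_le f hf (le_max_left _ _),
      sum_nthLargest_of_card_le g hg (le_max_right _ _), htot]

/-! ### Squeezed functions and support points -/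

theorem squeeze_natCast (f : ℤ → ℝ) (hf : (Function.support f).Finite)
    (r : Fin hf.toFinset.card) :
    squeeze f hf ((r : ℕ) : ℤ) = f (hf.toFinset.orderEmbOfFin rfl r) := by
  unfold squeeze
  rw [Finset.sum_eq_single r]
  · simp
  · intro q _ hq
    refine Set.indicator_of_notMem ?_ _
    rw [Set.mem_singleton_iff, Nat.cast_inj]
    exact fun h => hq (Fin.ext h.symm)
  · simp

theorem squeeze_eq_zero (f : ℤ → ℝ) (hf : (Function.support f).Finite) {k : ℤ}
    (hk : ¬(0 ≤ k ∧ k < hf.toFinset.card)) : squeeze f hf k = 0 := by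
  refine Finset.sum_eq_zero fun r _ => Set.indicator_of_notMem ?_ _
  rw [Set.mem_singleton_iff]
  rintro rfl
  exact hk ⟨by lia, by exact_mod_cast r.2⟩

theorem squeeze_pos_iff {f : ℤ → ℝ} (f0 : ∀ x, 0 ≤ f x) (hf : (Function.support f).Finite)
    (k : ℤ) : 0 < squeeze f hf k ↔ 0 ≤ k ∧ k < hf.toFinset.card := by
  refine ⟨fun h => ?_, fun ⟨h1, h2⟩ => ?_⟩
  · by_contra hk
    exact h.ne' (squeeze_eq_zero f hf hk)
  · lift k to ℕ using h1
    rw [squeeze_natCast f hf ⟨k, by exact_mod_cast h2⟩]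
    refine (f0 _).lt_of_ne' ?_
    have := hf.toFinset.orderEmbOfFin_mem rfl ⟨k, by exact_mod_cast h2⟩
    exact hf.mem_toFinset.1 this

theorem squeeze_nonneg {f : ℤ → ℝ} (f0 : ∀ x, 0 ≤ f x) (hf : (Function.support f).Finite)
    (k : ℤ) : 0 ≤ squeeze f hf k := by
  by_cases h : 0 ≤ k ∧ k < hf.toFinset.card
  · exact ((squeeze_pos_iff f0 hf k).2 h).le
  · exact (squeeze_eq_zero f hf h).ge

theorem IsHashLogConcave.isPF2_squeeze {f : ℤ → ℝ} {hf : (Function.support f).Finite}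
    (h : IsHashLogConcave f hf) (f0 : ∀ x, 0 ≤ f x) : IsPF2 (squeeze f hf) := by
  refine IsLogConcaveSeq.isPF2 h (squeeze_nonneg f0 hf) fun p i q hpi hiq hp hq => ?_
  rw [squeeze_pos_iff f0] at hp hq ⊢
  lia

/-- The support points of a finitely supported function in increasing order, indexed from `0`. -/
noncomputable def supportPoint (f : ℤ → ℝ) (hf : (Function.support f).Finite) (i : ℤ) : ℤ :=
  if h : i.toNat < hf.toFinset.card then hf.toFinset.orderEmbOfFin rfl ⟨i.toNat, h⟩ else 0

theorem supportPoint_natCast (f : ℤ → ℝ) (hf : (Function.support f).Finite)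
    (r : Fin hf.toFinset.card) :
    supportPoint f hf ((r : ℕ) : ℤ) = hf.toFinset.orderEmbOfFin rfl r := by
  simp [supportPoint]

theorem supportPoint_lt_succ {f : ℤ → ℝ} (f0 : ∀ x, 0 ≤ f x) (hf : (Function.support f).Finite)
    {i : ℤ} (h : 0 < squeeze f hf i) (h' : 0 < squeeze f hf (i + 1)) :
    supportPoint f hf i < supportPoint f hf (i + 1) := by
  rw [squeeze_pos_iff f0] at h h'
  obtain ⟨i, rfl⟩ := Int.eq_ofNat_of_zero_le h.1
  have h1 := supportPoint_natCast f hf ⟨i, by lia⟩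
  have h2 := supportPoint_natCast f hf ⟨i + 1, by lia⟩
  push_cast at h1 h2
  rw [h1, h2]
  exact (hf.toFinset.orderEmbOfFin rfl).strictMono (Fin.mk_lt_mk.2 (by lia))

theorem sum_squeeze_mul (f : ℤ → ℝ) (hf : (Function.support f).Finite) (φ : ℤ → ℝ) :
    ∑ i ∈ range hf.toFinset.card, squeeze f hf i * φ (supportPoint f hf i) =
      ∑ y ∈ hf.toFinset, f y * φ y := by
  rw [Finset.sum_range fun i : ℕ => squeeze f hf i * φ (supportPoint f hf i)]
  simp only [squeeze_natCast, supportPoint_natCast]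
  conv_rhs => rw [← Finset.map_orderEmbOfFin_univ hf.toFinset rfl, Finset.sum_map]
  rfl

theorem sum_range_shift {h : ℤ → ℝ} {n : ℕ} (hn : ∀ i : ℤ, ¬(0 ≤ i ∧ i < n) → h i = 0)
    {r M : ℕ} (hr : r < M) :
    ∑ s ∈ range (M + n), h ((s : ℤ) - r) = ∑ i ∈ range n, h i := by
  rw [show M + n = r + n + (M - r) by lia, Finset.sum_range_add, Finset.sum_range_add,
    Finset.sum_eq_zero, Finset.sum_eq_zero (s := range (M - r)), zero_add, add_zero]
  · refine sum_congr rfl fun i _ => ?_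
    congr 1
    push_cast
    ring
  · intro i _
    exact hn _ (by push_cast; lia)
  · intro i hi
    rw [mem_range] at hi
    exact hn _ (by lia)

/-! ### Laws of sums of independent integer variables -/

section Probability

open MeasureTheory ProbabilityTheory

theorem measurable_sum_of_measurable {Ω ι : Type*} [MeasurableSpace Ω] {X : ι → Ω → ℤ}
    (hX : ∀ j, Measurable (X j)) (s : Finset ι) : Measurable (∑ j ∈ s, X j) :=
  Finset.sum_induction _ _ (fun _ _ => Measurable.add) measurable_zero fun j _ => hX j

variable {Ω : Type*} [MeasurableSpace Ω] {μ : Measure Ω} [IsProbabilityMeasure μ]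

theorem measureReal_eq_sum_inter_preimage {X : Ω → ℤ} (hX : Measurable X) {T : Finset ℤ}
    (hT : ∀ x ∉ T, massFn μ X x = 0) {E : Set Ω} (hE : MeasurableSet E) :
    μ.real E = ∑ x ∈ T, μ.real (X ⁻¹' {x} ∩ E) := by
  have hnull : μ (X ⁻¹' (T : Set ℤ)ᶜ) = 0 := by
    rw [← Set.biUnion_preimage_singleton, measure_biUnion_null_iff (Set.to_countable _)]
    intro x hx
    exact (measureReal_eq_zero_iff).1 (hT x hx)
  rw [← measureReal_biUnion_finset]
  · rw [← Set.iUnion₂_inter]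
    refine measureReal_congr ?_
    have : ∀ᵐ ω ∂μ, X ω ∈ T := by
      rw [ae_iff]
      exact hnull
    filter_upwards [this] with ω hω
    refine propext ⟨fun h => ⟨?_, h⟩, fun h => h.2⟩
    exact Set.mem_iUnion₂.2 ⟨X ω, hω, rfl⟩
  · intro x _ y _ hxy
    refine Set.disjoint_left.2 fun ω h1 h2 => hxy ?_
    exact h1.1.symm.trans h2.1
  · exact fun x _ => (hX (measurableSet_singleton x)).inter hE

theorem sum_massFn_eq_one {X : Ω → ℤ} (hX : Measurable X) {T : Finset ℤ}
    (hT : ∀ x ∉ T, massFn μ X x = 0) : ∑ x ∈ T, massFn μ X x = 1 := by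
  have := measureReal_eq_sum_inter_preimage hX hT (μ := μ) MeasurableSet.univ
  rw [probReal_univ] at this
  simpa [massFn] using this.symm

theorem measureReal_add_mem {X Y : Ω → ℤ} (hX : Measurable X) (hY : Measurable Y)
    (hXY : IndepFun X Y μ) {T : Finset ℤ} (hT : ∀ x ∉ T, massFn μ X x = 0) (B : Set ℤ) :
    μ.real {ω | X ω + Y ω ∈ B} = ∑ x ∈ T, massFn μ X x * μ.real {ω | x + Y ω ∈ B} := by
  rw [measureReal_eq_sum_inter_preimage hX hT]
  · refine sum_congr rfl fun x _ => ?_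
    have h1 : X ⁻¹' {x} ∩ {ω | X ω + Y ω ∈ B} = X ⁻¹' {x} ∩ Y ⁻¹' {y | x + y ∈ B} := by
      ext ω
      simp only [Set.mem_inter_iff, Set.mem_preimage, Set.mem_singleton_iff, Set.mem_ofPred_eq]
      refine and_congr_right fun h => ?_
      rw [h]
    rw [h1, measureReal_def,
      hXY.measure_inter_preimage_eq_mul _ _ (measurableSet_singleton x)
        (MeasurableSet.of_discrete), ENNReal.toReal_mul]
    rfl
  · exact (hX.add hY) MeasurableSet.of_discrete

theorem finite_support_massFn_add {X Y : Ω → ℤ} (hX : Measurable X) (hY : Measurable Y)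
    (hXY : IndepFun X Y μ) (hXf : (Function.support (massFn μ X)).Finite)
    (hYf : (Function.support (massFn μ Y)).Finite) :
    (Function.support (massFn μ (X + Y))).Finite := by
  refine (hXf.add hYf).subset fun t ht => ?_
  have h := measureReal_add_mem hX hY hXY (T := hXf.toFinset) (fun x hx => by simpa using hx) {t}
  have ht' : μ.real {ω | X ω + Y ω ∈ ({t} : Set ℤ)} ≠ 0 := ht
  rw [h] at ht'
  obtain ⟨x, hx, hne⟩ := Finset.exists_ne_zero_of_sum_ne_zero ht'
  refine ⟨x, left_ne_zero_of_mul hne, t - x, ?_, by simp⟩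
  have := right_ne_zero_of_mul hne
  rw [Function.mem_support, massFn]
  convert this using 3
  ext ω
  simp only [Set.mem_preimage, Set.mem_singleton_iff, Set.mem_ofPred_eq]
  lia

theorem finite_support_massFn_sum {ι : Type*} {X : ι → Ω → ℤ} (hX : ∀ j, Measurable (X j))
    (hind : iIndepFun X μ) (hfin : ∀ j, (Function.support (massFn μ (X j))).Finite)
    (s : Finset ι) : (Function.support (massFn μ (∑ j ∈ s, X j))).Finite := by
  classical
  induction s using Finset.induction_on with
  | empty =>
    refine (Set.finite_singleton (0 : ℤ)).subset fun t ht => ?_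
    by_contra h
    refine ht ?_
    have : ((∑ j ∈ (∅ : Finset ι), X j) ⁻¹' {t} : Set Ω) = ∅ := by
      ext ω
      simpa using fun h' => h h'.symm
    rw [massFn, this, measureReal_empty]
  | insert j s hj ih =>
    rw [Finset.sum_insert hj]
    exact finite_support_massFn_add (hX j) (measurable_sum_of_measurable hX s)
      (hind.indepFun_finsetSum_of_notMem hX hj).symm (hfin j) ih

theorem massFn_eq_sub {X : Ω → ℤ} (hX : Measurable X) (t : ℤ) :
    massFn μ X t = μ.real {ω | X ω ≤ t} - μ.real {ω | X ω ≤ t - 1} := by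
  rw [← measureReal_sdiff]
  · rw [massFn]
    congr 1
    ext ω
    simp only [Set.mem_preimage, Set.mem_singleton_iff, Set.mem_sdiff, Set.mem_ofPred_eq]
    lia
  · intro ω (hω : X ω ≤ t - 1)
    change X ω ≤ t
    lia
  · exact hX (MeasurableSet.of_discrete (s := Set.Iic (t - 1)))

/-- `Φ r` plays the conditional distribution function of the sum given its rank. Only laws enter, so
the two probability spaces need no coupling. -/
theorem exists_isRankedFamily {Ω' : Type*} [MeasurableSpace Ω'] {ν : Measure Ω'}
    [IsProbabilityMeasure ν] {ι : Type*} {X : ι → Ω → ℤ} (hX : ∀ j, Measurable (X j))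
    (hXindep : iIndepFun X μ) (hXfin : ∀ j, (Function.support (massFn μ (X j))).Finite)
    (hXlc : ∀ j, IsHashLogConcave (massFn μ (X j)) (hXfin j))
    {Y : ι → Ω' → ℤ} (hY : ∀ j, Measurable (Y j)) (hYindep : iIndepFun Y ν)
    (hYlaw : ∀ j, massFn ν (Y j) = squeeze (massFn μ (X j)) (hXfin j)) (s : Finset ι) :
    ∃ (M : ℕ) (Φ : ℤ → ℤ → ℝ), IsRankedFamily (massFn ν (∑ j ∈ s, Y j)) Φ M ∧
      ∀ t, μ.real {ω | (∑ j ∈ s, X j) ω ≤ t} =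
        ∑ r ∈ range M, massFn ν (∑ j ∈ s, Y j) r * Φ r t := by
  classical
  induction s using Finset.induction_on with
  | empty =>
    have hW : massFn ν (∑ j ∈ (∅ : Finset ι), Y j) = fun r => if r = 0 then 1 else 0 := by
      funext r
      rw [massFn]
      split_ifs with h
      · subst h
        rw [show ((∑ j ∈ (∅ : Finset ι), Y j) ⁻¹' {0} : Set Ω') = Set.univ by ext; simp,
          probReal_univ]
      · rw [show ((∑ j ∈ (∅ : Finset ι), Y j) ⁻¹' {r} : Set Ω') = ∅ by
          ext; simpa using fun h' => h h'.symm, measureReal_empty]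
    refine ⟨1, fun _ t => if 0 ≤ t then 1 else 0, ?_, fun t => ?_⟩
    · rw [hW]
      refine ⟨?_, ?_, ?_, ?_, ?_, ?_, ?_⟩
      · intro p q x y h1 h2 h3
        dsimp only
        split_ifs <;> first | lia | norm_num
      · intro r hr
        refine if_neg ?_
        push_cast at hr
        lia
      · intro r
        split_ifs <;> norm_num
      · intro _ t
        split_ifs <;> norm_num
      · intro _ t
        split_ifs <;> norm_num
      · intro _ t t' h
        dsimp only
        split_ifs <;> first | lia | norm_num
      · intro r t h1 h2
        have e1 : r = 0 := by by_contra h; simp [h] at h1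
        have e2 : r + 1 = 0 := by by_contra h; simp [h] at h2
        lia
    · rw [hW]
      by_cases ht : 0 ≤ t <;> simp [ht]
  | insert j s hj ih =>
    obtain ⟨M, Φ, hR, hcdf⟩ := ih
    have f0 : ∀ x, 0 ≤ massFn μ (X j) x := fun x => measureReal_nonneg
    set f := squeeze (massFn μ (X j)) (hXfin j) with hf
    set x := supportPoint (massFn μ (X j)) (hXfin j) with hx
    set n := (hXfin j).toFinset.card with hn
    set W := massFn ν (∑ j ∈ s, Y j) with hWdef
    have fpf : IsPF2 f := (hXlc j).isPF2_squeeze f0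
    have fnn : ∀ i, 0 ≤ f i := squeeze_nonneg f0 _
    have fsupp : ∀ r : ℤ, ¬(0 ≤ r ∧ r < n) → f r = 0 := fun r hr => squeeze_eq_zero _ _ hr
    have hconv := hR.conv fpf fnn fsupp (x := x) fun i h h' => supportPoint_lt_succ f0 _ h h'
    have hW' : massFn ν (∑ j ∈ insert j s, Y j) = fun k => ∑ r ∈ range M, W r * f (k - r) := by
      funext k
      have h := measureReal_add_mem (measurable_sum_of_measurable hY s) (hY j)
        (hYindep.indepFun_finsetSum_of_notMem hY hj) (T := (range M).map Nat.castEmbedding)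
        (fun r hr => hR.supp r fun hr' => hr (mem_map.2
          ⟨r.toNat, by rw [mem_range]; lia, by simp [hr'.1]⟩)) {k}
      rw [sum_map] at h
      rw [sum_insert hj, add_comm]
      refine h.trans (sum_congr rfl fun r _ => ?_)
      rw [hf, ← hYlaw j]
      congr 1
      rw [massFn]
      congr 1
      ext ω
      simp only [Set.mem_preimage, Set.mem_singleton_iff, Set.mem_ofPred_eq,
        Nat.castEmbedding_apply]
      lia
    rw [hW']
    refine ⟨M + n, _, hconv, fun t => ?_⟩
    have h := measureReal_add_mem (hX j) (measurable_sum_of_measurable hX s)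
      (hXindep.indepFun_finsetSum_of_notMem hX hj).symm (T := (hXfin j).toFinset)
      (fun y hy => by simpa using hy) (Set.Iic t)
    rw [sum_insert hj]
    refine h.trans ?_
    have hterm : ∀ y, μ.real {ω | y + (∑ j ∈ s, X j) ω ∈ Set.Iic t} =
        ∑ r ∈ range M, W r * Φ r (t - y) := by
      intro y
      rw [← hcdf]
      congr 1
      ext ω
      simp only [Set.mem_Iic, Set.mem_ofPred_eq]
      lia
    simp only [hterm]
    rw [← sum_squeeze_mul _ (hXfin j) fun y => ∑ r ∈ range M, W r * Φ r (t - y)]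
    -- A zero denominator is a vanishing sum of nonnegative terms, so the numerator vanishes too.
    have hcancel : ∀ k : ℤ, (∑ r ∈ range M, W r * f (k - r)) *
        ((∑ r ∈ range M, W r * f (k - r) * Φ r (t - x (k - r))) / ∑ r ∈ range M, W r * f (k - r)) =
        ∑ r ∈ range M, W r * f (k - r) * Φ r (t - x (k - r)) := by
      intro k
      refine mul_div_cancel_of_imp' fun h0 => ?_
      rw [sum_eq_zero_iff_of_nonneg fun r _ => mul_nonneg (hR.weight_nonneg _) (fnn _)] at h0
      exact sum_eq_zero fun r hr => by rw [h0 r hr, zero_mul]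
    simp only [hcancel]
    rw [sum_comm]
    simp only [mul_sum]
    rw [sum_comm]
    refine sum_congr rfl fun r hr => ?_
    rw [← hf, ← hx, ← hn]
    -- Off the ranks below `n` the factor `f` is zero, so the default values of `x` there play no
    -- role.
    rw [sum_range_shift (h := fun i => W r * f i * Φ r (t - x i))
      (fun i hi => by rw [fsupp i hi]; simp) (mem_range.1 hr)]
    exact sum_congr rfl fun i _ => by ring

end Probability

theorem theorem1 {Ω Ω' : Type*} [MeasurableSpace Ω] [MeasurableSpace Ω']
    (μ : MeasureTheory.Measure Ω) [MeasureTheory.IsProbabilityMeasure μ]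
    (ν : MeasureTheory.Measure Ω') [MeasureTheory.IsProbabilityMeasure ν]
    (N : ℕ)
    (X : Fin N → Ω → ℤ) (hX : ∀ j, Measurable (X j))
    (hXindep : ProbabilityTheory.iIndepFun X μ)
    (hXfin : ∀ j, (Function.support (massFn μ (X j))).Finite)
    (hXlc : ∀ j, IsHashLogConcave (massFn μ (X j)) (hXfin j))
    (Xhash : Fin N → Ω' → ℤ) (hXhash : ∀ j, Measurable (Xhash j))
    (hXhashIndep : ProbabilityTheory.iIndepFun Xhash ν)
    (hXhashLaw : ∀ j, massFn ν (Xhash j) = squeeze (massFn μ (X j)) (hXfin j)) :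
    Majorized (massFn μ (fun ω => ∑ j, X j ω)) (massFn ν (fun ω => ∑ j, Xhash j ω)) := by
  rw [show (fun ω => ∑ j, X j ω) = ∑ j, X j by ext; simp,
    show (fun ω => ∑ j, Xhash j ω) = ∑ j, Xhash j by ext; simp]
  obtain ⟨M, Φ, hR, hcdf⟩ :=
    exists_isRankedFamily hX hXindep hXfin hXlc hXhash hXhashIndep hXhashLaw Finset.univ
  have hS := measurable_sum_of_measurable hX Finset.univ
  have hS' := measurable_sum_of_measurable hXhash Finset.univ
  have hfin := finite_support_massFn_sum hX hXindep hXfin Finset.univ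
  have hfin' := finite_support_massFn_sum hXhash hXhashIndep (fun j => by
    rw [hXhashLaw]
    refine (Set.finite_Ico (0 : ℤ) (hXfin j).toFinset.card).subset fun r hr => ?_
    by_contra h
    exact hr (squeeze_eq_zero _ _ h)) Finset.univ
  refine Majorized.of_threshold hfin hfin' (fun _ => MeasureTheory.measureReal_nonneg) ?_ ?_
  · rw [sum_massFn_eq_one hS fun x hx => by simpa using hx,
      sum_massFn_eq_one hS' fun x hx => by simpa using hx]
  · intro c hc
    have hmass : ∀ t, massFn μ (∑ j, X j) t =
        ∑ r ∈ range M, massFn ν (∑ j, Xhash j) r * (Φ r t - Φ r (t - 1)) := by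
      intro t
      rw [massFn_eq_sub hS, hcdf, hcdf, ← sum_sub_distrib]
      exact sum_congr rfl fun r _ => by ring
    simp only [hmass]
    refine (hR.sum_posPart_sub_le hc _).trans_eq ?_
    refine (sum_map (range M) Nat.castEmbedding
      fun r => max (massFn ν (∑ j, Xhash j) r - c) 0).symm.trans (Eq.symm ?_)
    refine sum_subset (fun r hr => ?_) fun r _ hr => ?_
    · rw [Set.Finite.mem_toFinset, Function.mem_support] at hr
      have hr' : 0 ≤ r ∧ r < M := by
        by_contra h
        exact hr (hR.supp r h)
      exact mem_map.2 ⟨r.toNat, by rw [mem_range]; lia, by simp [hr'.1]⟩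
    · rw [Set.Finite.mem_toFinset, Function.notMem_support] at hr
      rw [hr]
      exact max_eq_right (by linarith)
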